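/- Let $\Gamma$ be a finite simple connected graph with vertex set $V(\Gamma)$, and let $$G(\Gamma)=A(\Gamma^c)=\langle\, v\in V(\Gamma)\mid [v,w]=1 \text{ if } v\neq w \text{ and } \{v,w\}\text{ is not an edge of }\Gamma\,\rangle$$ be the right-angled Artin group on the complement graph of $\Gamma$. For $g\in G(\Gamma)$ let $|g|$ be the word length of $g$ with respect to the generators $V(\Gamma)$, and let $\operatorname{supp}(g)$ be the set of all $v\in V(\Gamma)$ such that $v$ or $v^{-1}$ appears in a shortest word representing $g$. A decomposition $g=g_1\cdots g_k$ is geodesic if $|g|=|g_1|+\cdots+|g_k|$. Elements $g,g'$ disjointly commute if $\operatorname{supp}(g)\cap\operatorname{supp}(g')=\emptyset$ and every $v\in\operatorname{supp}(g)$ commutes in $G(\Gamma)$ with every $v'\in\operatorname{supp}(g')$. An element $g$ is strongly non-split if $\operatorname{supp}(g)$ spans a connected subgraph of $\Gamma$ and no generator $v\in V(\Gamma)$ disjointly commutes with $g$. An element $g\neq 1$ is primitive if $g\neq u^n$ for all $n\ge 2$ and $u\in G(\Gamma)$. For real numbers $\lambda,N$ and $h\in G(\Gamma)$, a $(\lambda,N)$-quasi-root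 decomposition of $h$ is a geodesic decomposition $h=ag^nb=a\cdot\underbrace{g\cdots g}_{n}\cdot b$ with $a,g,b\in G(\Gamma)$, an integer $n\ge N$, and $|a|,|b|\le\lambda|h|$. **Theorem.** Let $0\le\lambda<\frac12$ and $N\ge\frac{2|V(\Gamma)|+1}{1-2\lambda}$. If $h\in G(\Gamma)$ has two $(\lambda,N)$-quasi-root decompositions $$h=a_1g_1^{n_1}b_1=a_2g_2^{n_2}b_2$$ such that $g_1$ and $g_2$ are strongly non-split and primitive, then $a_1g_1a_1^{-1}=a_2g_2a_2^{-1}$ and $b_1^{-1}g_1b_1=b_2^{-1}g_2b_2$; in particular, $g_1$ and $g_2$ are conjugate in $G(\Gamma)$. -/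

import Mathlib

namespace QuasiRoot

/-- The relators of the right-angled Artin group on `Γ`: the commutators `[v, w]`
for all edges `{v, w}` of `Γ`. -/
def raagRels {V : Type*} (Γ : SimpleGraph V) : Set (FreeGroup V) :=
  {r | ∃ v w : V, Γ.Adj v w ∧
    r = FreeGroup.of v * FreeGroup.of w * (FreeGroup.of v)⁻¹ * (FreeGroup.of w)⁻¹}

/-- The right-angled Artin group `A(Γ) = ⟨V | [v, w] = 1 if {v, w} is an edge⟩`. -/
abbrev RAAG {V : Type*} (Γ : SimpleGraph V) : Type _ := PresentedGroup (raagRels Γ)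

/-- The right-angled Artin group with the opposite convention, `G(Γ) = A(Γᶜ)`: two
distinct generators commute if they are not adjacent in `Γ`. -/
abbrev OppRAAG {V : Type*} (Γ : SimpleGraph V) : Type _ := RAAG Γᶜ

section

variable {V : Type*} {Γ : SimpleGraph V}

/-- The generator of `G(Γ)` given by a vertex. -/
def gen (Γ : SimpleGraph V) (v : V) : OppRAAG Γ := PresentedGroup.of v

/-- The element of `G(Γ)` given by a letter: `(v, true)` stands for `v` and
`(v, false)` for `v⁻¹`. -/
def letter (Γ : SimpleGraph V) (x : V × Bool) : OppRAAG Γ :=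
  if x.2 then gen Γ x.1 else (gen Γ x.1)⁻¹

/-- The element of `G(Γ)` represented by a word, i.e. by a finite sequence of letters. -/
def ofWord (Γ : SimpleGraph V) (w : List (V × Bool)) : OppRAAG Γ :=
  (w.map (letter Γ)).prod

/-- Every element of `G(Γ)` is represented by a word. -/
theorem ofWord_surjective (Γ : SimpleGraph V) : Function.Surjective (ofWord Γ) := by
  classical
  intro g
  obtain ⟨x, rfl⟩ := PresentedGroup.mk_surjective _ g
  refine ⟨x.toWord, ?_⟩
  have key : ∀ w : List (V × Bool),
      ofWord Γ w = PresentedGroup.mk (raagRels Γᶜ) (FreeGroup.mk w) := by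
    intro w
    induction w with
    | nil => exact (map_one (PresentedGroup.mk (raagRels Γᶜ))).symm
    | cons a w ih =>
      have h1 : FreeGroup.mk (a :: w) = FreeGroup.mk [a] * FreeGroup.mk w := by
        rw [FreeGroup.mul_mk]; rfl
      have h2 : letter Γ a = PresentedGroup.mk (raagRels Γᶜ) (FreeGroup.mk [a]) := by
        obtain ⟨v, b⟩ := a
        cases b <;> rfl
      rw [h1, map_mul, ← ih, ← h2]
      simp [ofWord]
  rw [key, FreeGroup.mk_toWord]

/-- A word is reduced if it is a shortest word among all words that represent the same
element of `G(Γ)`. -/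
def IsReducedWord (Γ : SimpleGraph V) (w : List (V × Bool)) : Prop :=
  ∀ w' : List (V × Bool), ofWord Γ w' = ofWord Γ w → w.length ≤ w'.length

/-- The word length `|g|`: the least length of a word representing `g`. -/
noncomputable def wordLength (g : OppRAAG Γ) : ℕ :=
  sInf {n : ℕ | ∃ w : List (V × Bool), ofWord Γ w = g ∧ w.length = n}

/-- The support of `g`: the vertices `v` such that `v` or `v⁻¹` appears in a reduced
word representing `g`. -/
def supp (g : OppRAAG Γ) : Set V :=
  {v | ∃ w : List (V × Bool),
    IsReducedWord Γ w ∧ ofWord Γ w = g ∧ ((v, true) ∈ w ∨ (v, false) ∈ w)}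

/-- `g₁` and `g₂` disjointly commute: their supports are disjoint and each generator in
the first commutes in `G(Γ)` with each generator in the second. -/
def DisjointlyCommute (g₁ g₂ : OppRAAG Γ) : Prop :=
  Disjoint (supp g₁) (supp g₂) ∧
    ∀ v₁ ∈ supp g₁, ∀ v₂ ∈ supp g₂, Commute (gen Γ v₁) (gen Γ v₂)

/-- `g` is non-split if its support spans a connected subgraph of `Γ`. -/
def IsNonSplit (g : OppRAAG Γ) : Prop :=
  (Γ.induce (supp g)).Connected

/-- `g` is strongly non-split if it is non-split and no generator disjointly commutes
with it. -/
def IsStronglyNonSplit (g : OppRAAG Γ) : Prop :=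
  IsNonSplit g ∧ ¬ ∃ v : V, DisjointlyCommute (gen Γ v) g

/-- `g = g₁ ⋯ g_k` is a geodesic decomposition, where `l = [g₁, …, g_k]`. -/
def IsGeodesicDecomposition (g : OppRAAG Γ) (l : List (OppRAAG Γ)) : Prop :=
  g = l.prod ∧ wordLength g = (l.map wordLength).sum

/-- `h = a gⁿ b = a · g ⋯ g · b` is a `(lam, N)`-quasi-root decomposition. -/
def IsQuasiRootDecomposition (lam N : ℝ) (h a g : OppRAAG Γ) (n : ℕ) (b : OppRAAG Γ) :
    Prop :=
  IsGeodesicDecomposition h (a :: (List.replicate n g ++ [b])) ∧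
    N ≤ n ∧
    (wordLength a : ℝ) ≤ lam * wordLength h ∧
    (wordLength b : ℝ) ≤ lam * wordLength h

end

/-- A nontrivial element of a group is primitive if it is not an `n`-th power for any
`n ≥ 2`. -/
def IsPrimitiveElement {G : Type*} [Group G] (g : G) : Prop :=
  g ≠ 1 ∧ ∀ n : ℕ, 2 ≤ n → ∀ u : G, g ≠ u ^ n

end QuasiRoot

/-! A word is studied through its projections to pairs of dependent vertices, i.e. equal or adjacent
ones, whose generators are the ones not made to commute. Words with equal projections differ by
commutations. Conversely, reduced words for one element have equal projections (`Irred.traceEq`, by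
van der Waerden's method: the group acts on families of projections). So both decompositions of `h`
give periodic prefixes `a gʲ` of a single trace.

Prefixes of one trace are governed by their letter counts: on a dependent pair the projections of
two prefixes are nested, so a strict excess at one vertex gives a weak excess at its neighbours
(`Pre.cnt_le_of_cnt_lt`). Moving along an edge in the connected support of `g` costs at most one
period, and every vertex depends on that support. A comparison of total lengths therefore becomes a
comparison at every vertex, up to fewer than `|V|` periods. Paying this at both ends, plus rounding,
uses the `2|V| + 1` periods provided by the bound on `N` (`overlap`).

Inside the overlap, the join `d` of `a₁` and `a₂` can be shifted by either period, in either order.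
This produces words `y₁`, `y₂` with `aᵢ gᵢ aᵢ⁻¹ d = d yᵢ` that commute as traces
(`exists_commuting_periods`). Commuting free words have proportional letter counts, and
connectedness makes the ratio global, so `y₁ᵉ = y₂ᶜ` with coprime exponents. Primitivity forces `y₁
= y₂` (`ofWord_eq_of_append_comm`). -/

namespace QuasiRoot

/-! ### Words and commuting letters -/

section

variable {V : Type*} {Γ : SimpleGraph V}

/-- Two vertices are dependent if they are equal or adjacent. -/
def Dep (Γ : SimpleGraph V) (v u : V) : Prop := v = u ∨ Γ.Adj v u

theorem Dep.symm {v u : V} (h : Dep Γ v u) : Dep Γ u v :=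
  h.imp Eq.symm fun h => h.symm

theorem Dep.refl (v : V) : Dep Γ v v := Or.inl rfl

/-- The formal inverse of a letter. -/
def invLetter (x : V × Bool) : V × Bool := (x.1, !x.2)

@[simp] theorem invLetter_fst (x : V × Bool) : (invLetter x).1 = x.1 := rfl

@[simp] theorem invLetter_invLetter (x : V × Bool) : invLetter (invLetter x) = x := by
  simp [invLetter]

@[simp] theorem ofWord_nil : ofWord Γ [] = 1 := rfl

theorem ofWord_cons (x : V × Bool) (w : List (V × Bool)) :
    ofWord Γ (x :: w) = letter Γ x * ofWord Γ w := by simp [ofWord]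

theorem ofWord_append (w w' : List (V × Bool)) :
    ofWord Γ (w ++ w') = ofWord Γ w * ofWord Γ w' := by simp [ofWord]

theorem letter_mul_letter_invLetter (x : V × Bool) :
    letter Γ x * letter Γ (invLetter x) = 1 := by
  obtain ⟨v, b⟩ := x
  cases b <;> simp [letter, invLetter]

theorem gen_commute {v u : V} (h : ¬ Dep Γ v u) : Commute (gen Γ v) (gen Γ u) := by
  have hadj : Γᶜ.Adj v u := by
    rw [SimpleGraph.compl_adj]
    exact ⟨fun e => h (Or.inl e), fun e => h (Or.inr e)⟩
  have h1 : PresentedGroup.mk (raagRels Γᶜ) (FreeGroup.of v * FreeGroup.of u *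
      (FreeGroup.of v)⁻¹ * (FreeGroup.of u)⁻¹) = 1 :=
    PresentedGroup.one_of_mem ⟨v, u, hadj, rfl⟩
  simp only [map_mul, map_inv] at h1
  have h2 := mul_inv_eq_one.1 h1
  exact mul_inv_eq_iff_eq_mul.1 h2

theorem letter_commute {x y : V × Bool} (h : ¬ Dep Γ x.1 y.1) :
    Commute (letter Γ x) (letter Γ y) := by
  have := gen_commute h
  unfold letter
  split_ifs <;> simp [this]

theorem letter_commute_ofWord {x : V × Bool} {q : List (V × Bool)}
    (h : ∀ y ∈ q, ¬ Dep Γ x.1 y.1) : Commute (letter Γ x) (ofWord Γ q) := by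
  induction q with
  | nil => simp
  | cons y q ih =>
    rw [ofWord_cons]
    exact (letter_commute (h y (by simp))).mul_right (ih fun z hz => h z (by simp [hz]))

theorem ofWord_move {x : V × Bool} {q : List (V × Bool)} (r : List (V × Bool))
    (hq : ∀ y ∈ q, ¬ Dep Γ x.1 y.1) : ofWord Γ (q ++ x :: r) = ofWord Γ (x :: (q ++ r)) := by
  simp only [ofWord_append, ofWord_cons, ← mul_assoc, (letter_commute_ofWord hq).eq]

theorem not_mem_of_not_dep {x y : V × Bool} (h : ¬ Dep Γ x.1 y.1)
    {p : {p : V × V // Dep Γ p.1 p.2}} (hx : x.1 = p.1.1 ∨ x.1 = p.1.2) :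
    ¬ (y.1 = p.1.1 ∨ y.1 = p.1.2) := by
  have h2 := p.2
  have h3 := p.2.symm
  rintro (hy | hy) <;> rcases hx with hx | hx <;> rw [hx, hy] at h <;>
    first | exact h (.refl _) | exact h h2 | exact h h3

/-! ### Traces, described by projections to dependent pairs -/

variable [DecidableEq V]

/-- The subword of all letters at the vertices `v` and `u`. -/
def proj (v u : V) (w : List (V × Bool)) : List (V × Bool) :=
  w.filter fun x => x.1 = v ∨ x.1 = u

theorem proj_comm (v u : V) (w : List (V × Bool)) : proj v u w = proj u v w := by
  simp [proj, or_comm]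

@[simp] theorem proj_nil (v u : V) : proj v u [] = [] := rfl

theorem proj_cons (v u : V) (x : V × Bool) (w : List (V × Bool)) :
    proj v u (x :: w) = if x.1 = v ∨ x.1 = u then x :: proj v u w else proj v u w := by
  simp [proj, List.filter_cons]

@[simp] theorem proj_append (v u : V) (w w' : List (V × Bool)) :
    proj v u (w ++ w') = proj v u w ++ proj v u w' := by
  simp [proj]

theorem proj_eq_nil_of_not_dep {x : V × Bool} {q : List (V × Bool)}
    (hq : ∀ y ∈ q, ¬ Dep Γ x.1 y.1) {v u : V} (hd : Dep Γ v u) (hx : x.1 = v ∨ x.1 = u) :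
    proj v u q = [] := by
  simp only [proj, List.filter_eq_nil_iff, decide_eq_true_eq]
  intro y hy h
  apply hq y hy
  have := hd.symm
  rcases hx with rfl | rfl <;> rcases h with h | h <;> rw [h] <;> first | exact .refl _ | assumption

/-- Two words are trace equivalent if they have the same projections to all pairs of
dependent vertices. -/
def TraceEq (Γ : SimpleGraph V) (w w' : List (V × Bool)) : Prop :=
  ∀ v u, Dep Γ v u → proj v u w = proj v u w'

/-- `w` is a prefix of `w'` up to trace equivalence. -/
def Pre (Γ : SimpleGraph V) (w w' : List (V × Bool)) : Prop :=
  ∀ v u, Dep Γ v u → proj v u w <+: proj v u w'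

/-- The word `w` can be rearranged to begin with `x`. -/
def Heads (Γ : SimpleGraph V) (x : V × Bool) (w : List (V × Bool)) : Prop :=
  ∀ u, Dep Γ x.1 u → [x] <+: proj x.1 u w

/-- Going through `w` up to the first letter at the vertex of `x`: an earlier letter dependent on
`x` would come first in their common projection. -/
theorem Heads.exists_split {x : V × Bool} {w : List (V × Bool)} (h : Heads Γ x w) :
    ∃ q r, w = q ++ x :: r ∧ ∀ y ∈ q, ¬ Dep Γ x.1 y.1 := by
  induction w with
  | nil => simpa using h x.1 (.refl _)
  | cons y w ih =>
    by_cases hy : y.1 = x.1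
    · have := h x.1 (.refl _)
      rw [proj_cons, if_pos (Or.inl hy), List.cons_prefix_cons] at this
      exact ⟨[], w, by simp [this.1], by simp⟩
    · have hd : ¬ Dep Γ x.1 y.1 := by
        intro hd
        have := h _ hd
        rw [proj_cons, if_pos (Or.inr rfl), List.cons_prefix_cons] at this
        exact hy (by rw [this.1])
      obtain ⟨q, r, rfl, hq⟩ := ih fun u hu => by
        have h1 := h u hu
        rwa [proj_cons, if_neg] at h1
        rintro (h2 | h2)
        · exact hy h2
        · exact hd (h2 ▸ hu)
      refine ⟨y :: q, r, rfl, ?_⟩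
      exact List.forall_mem_cons.2 ⟨hd, hq⟩

theorem traceEq_move {x : V × Bool} {q : List (V × Bool)} (r : List (V × Bool))
    (hq : ∀ y ∈ q, ¬ Dep Γ x.1 y.1) : TraceEq Γ (q ++ x :: r) (x :: (q ++ r)) := by
  intro v u hd
  simp only [proj_append, proj_cons]
  split_ifs with h
  · simp [proj_eq_nil_of_not_dep hq hd h]
  · rfl

theorem Pre.heads {x : V × Bool} {w w' : List (V × Bool)} (h : Pre Γ (x :: w) w') :
    Heads Γ x w' := by
  intro u hu
  have := h _ _ hu
  rw [proj_cons, if_pos (Or.inl rfl)] at this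
  exact (List.prefix_append [x] _).trans this

theorem TraceEq.pre {w w' : List (V × Bool)} (h : TraceEq Γ w w') : Pre Γ w w' :=
  fun v u hd => by rw [h v u hd]

/-- The letters of `w` are moved to the front of `w'` and stripped one at a time; the rest of `w'`
is the complement. -/
theorem Pre.exists_append {w w' : List (V × Bool)} (h : Pre Γ w w') :
    ∃ t, TraceEq Γ (w ++ t) w' := by
  induction w generalizing w' with
  | nil => exact ⟨w', fun _ _ _ => rfl⟩
  | cons x w ih =>
    obtain ⟨q, r, rfl, hq⟩ := h.heads.exists_split
    have hm := traceEq_move r hq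
    obtain ⟨t, ht⟩ := ih (w' := q ++ r) fun v u hd => by
      have h1 := h v u hd
      rw [hm v u hd, proj_cons, proj_cons] at h1
      split_ifs at h1
      · exact (List.cons_prefix_cons.1 h1).2
      · exact h1
    refine ⟨t, fun v u hd => ?_⟩
    rw [hm v u hd, List.cons_append, proj_cons, proj_cons, ht v u hd]

theorem TraceEq.ofWord_eq {w w' : List (V × Bool)} (h : TraceEq Γ w w') :
    ofWord Γ w = ofWord Γ w' := by
  induction w generalizing w' with
  | nil =>
    cases w' with
    | nil => rfl
    | cons x w' => simpa [proj_cons] using h x.1 x.1 (.refl _)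
  | cons x w ih =>
    obtain ⟨q, r, rfl, hq⟩ := h.pre.heads.exists_split
    have hm := traceEq_move r hq
    rw [ofWord_move r hq, ofWord_cons, ofWord_cons, ih (w' := q ++ r)]
    intro v u hd
    have h1 := h v u hd
    rw [hm v u hd, proj_cons, proj_cons] at h1
    split_ifs at h1
    · exact (List.cons_eq_cons.1 h1).2
    · exact h1

/-! ### Irreducible words and the action on families of projections -/

/-- A word has no pair of inverse letters that can be brought together and cancelled. -/
def Irred (Γ : SimpleGraph V) : List (V × Bool) → Prop
  | [] => True
  | x :: w => Irred Γ w ∧ ¬ Heads Γ (invLetter x) w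

theorem irred_nil : Irred Γ [] := trivial

theorem Irred.erase {x : V × Bool} {q r : List (V × Bool)} (h : Irred Γ (q ++ x :: r))
    (hq : ∀ y ∈ q, ¬ Dep Γ x.1 y.1) : Irred Γ (q ++ r) := by
  induction q with
  | nil => exact h.1
  | cons y q ih =>
    refine ⟨ih h.1 fun z hz => hq z (by simp [hz]), fun h1 => h.2 fun u hu => ?_⟩
    have hy := hq y (by simp)
    have h2 := h1 u hu
    rw [invLetter_fst] at h2 hu ⊢
    rw [List.append_eq] at h2 ⊢
    rwa [proj_append, proj_cons, if_neg, ← proj_append]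
    rintro (h3 | h3)
    · exact hy (Or.inl h3)
    · exact hy (by rw [h3]; exact hu.symm)

theorem IsReducedWord.irred {w : List (V × Bool)} (h : IsReducedWord Γ w) : Irred Γ w := by
  induction w with
  | nil => trivial
  | cons x w ih =>
    refine ⟨ih fun w' hw' => ?_, fun hh => ?_⟩
    · have := h (x :: w') (by rw [ofWord_cons, ofWord_cons, hw'])
      simpa using this
    · obtain ⟨q, r, rfl, hq⟩ := hh.exists_split
      have := h (q ++ r) (by
        rw [ofWord_cons, ofWord_move r hq, ofWord_cons, ← mul_assoc,
          letter_mul_letter_invLetter, one_mul])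
      simp at this

/-- A family of words, one for each pair of dependent vertices. -/
abbrev Family (Γ : SimpleGraph V) : Type _ := {p : V × V // Dep Γ p.1 p.2} → List (V × Bool)

/-- The family of all projections of a word. -/
def family (Γ : SimpleGraph V) (w : List (V × Bool)) : Family Γ := fun p => proj p.1.1 p.1.2 w

theorem family_eq_iff {w w' : List (V × Bool)} :
    family Γ w = family Γ w' ↔ TraceEq Γ w w' :=
  ⟨fun h v u hd => congrFun h ⟨(v, u), hd⟩, fun h => funext fun p => h _ _ p.2⟩

/-- All words in the family at pairs containing the vertex of `x` begin with `x`. -/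
def Family.Heads (x : V × Bool) (F : Family Γ) : Prop :=
  ∀ p, x.1 = p.1.1 ∨ x.1 = p.1.2 → [x] <+: F p

theorem heads_family_iff {x : V × Bool} {w : List (V × Bool)} :
    (family Γ w).Heads x ↔ Heads Γ x w := by
  constructor
  · intro h u hu
    exact h ⟨(x.1, u), hu⟩ (Or.inl rfl)
  · rintro h ⟨⟨v, u⟩, hd⟩ (rfl | rfl)
    · exact h _ hd
    · have := h _ hd.symm
      rwa [proj_comm] at this

/-- Put the letter `x` in front of a family. -/
def Family.add (x : V × Bool) (F : Family Γ) : Family Γ := fun p =>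
  if x.1 = p.1.1 ∨ x.1 = p.1.2 then x :: F p else F p

/-- Remove the first letter at all pairs containing the vertex of `x`. -/
def Family.rem (x : V × Bool) (F : Family Γ) : Family Γ := fun p =>
  if x.1 = p.1.1 ∨ x.1 = p.1.2 then (F p).tail else F p

open Classical in
/-- The action of a letter on families. -/
noncomputable def Family.act (x : V × Bool) (F : Family Γ) : Family Γ :=
  if F.Heads (invLetter x) then F.rem x else F.add x

theorem family_cons (x : V × Bool) (w : List (V × Bool)) :
    family Γ (x :: w) = (family Γ w).add x := by
  funext p
  simp [family, Family.add, proj_cons]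

theorem Family.rem_add (x y : V × Bool) (h : x.1 = y.1) (F : Family Γ) :
    (F.add x).rem y = F := by
  funext p
  simp only [Family.add, Family.rem, h]
  split_ifs <;> rfl

theorem Family.act_apply_of_ne (x : V × Bool) (F : Family Γ) {p}
    (h : ¬ (x.1 = p.1.1 ∨ x.1 = p.1.2)) : F.act x p = F p := by
  unfold Family.act Family.add Family.rem
  split_ifs <;> exact if_neg h

theorem Family.heads_act_iff {x y z : V × Bool} (hz : z.1 = x.1) (h : ¬ Dep Γ x.1 y.1)
    (F : Family Γ) : (F.act y).Heads z ↔ F.Heads z := by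
  unfold Family.Heads
  rw [hz]
  refine forall_congr' fun p => forall_congr' fun hp => ?_
  rw [F.act_apply_of_ne y (not_mem_of_not_dep h hp)]

theorem Family.act_apply_congr {x : V × Bool} {F F' : Family Γ} {p}
    (hF : F.Heads (invLetter x) ↔ F'.Heads (invLetter x)) (hp : F p = F' p) :
    F.act x p = F'.act x p := by
  by_cases h : F'.Heads (invLetter x)
  · rw [Family.act, Family.act, if_pos h, if_pos (hF.2 h), Family.rem, Family.rem, hp]
  · rw [Family.act, Family.act, if_neg h, if_neg (hF.not.2 h), Family.add, Family.add, hp]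

/-- No dependent pair contains two independent vertices, so the two letters act on disjoint sets of
coordinates. -/
theorem Family.act_comm {x y : V × Bool} (h : ¬ Dep Γ x.1 y.1) (F : Family Γ) :
    (F.act y).act x = (F.act x).act y := by
  funext p
  have h' : ¬ Dep Γ y.1 x.1 := fun e => h e.symm
  by_cases hx : x.1 = p.1.1 ∨ x.1 = p.1.2
  · have hy := not_mem_of_not_dep h hx
    rw [Family.act_apply_of_ne y _ hy]
    exact Family.act_apply_congr (Family.heads_act_iff (z := invLetter x) rfl h F) (Family.act_apply_of_ne y _ hy)
  · rw [Family.act_apply_of_ne x _ hx]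
    exact (Family.act_apply_congr (Family.heads_act_iff (z := invLetter y) rfl h' F)
      (Family.act_apply_of_ne x _ hx)).symm

theorem act_family_of_not_heads {x : V × Bool} {w : List (V × Bool)}
    (h : ¬ Heads Γ (invLetter x) w) : (family Γ w).act x = family Γ (x :: w) := by
  rw [Family.act, if_neg (by rwa [heads_family_iff]), family_cons]

theorem act_family_of_split {x : V × Bool} {q r : List (V × Bool)}
    (hq : ∀ y ∈ q, ¬ Dep Γ x.1 y.1) :
    (family Γ (q ++ invLetter x :: r)).act x = family Γ (q ++ r) := by
  have h1 : family Γ (q ++ invLetter x :: r) = (family Γ (q ++ r)).add (invLetter x) := by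
    rw [← family_cons, family_eq_iff]
    exact traceEq_move r hq
  rw [Family.act, if_pos, h1, Family.rem_add (invLetter x) x rfl]
  rw [h1]
  intro p hp
  rw [Family.add, if_pos hp]
  exact List.prefix_append [_] _

/-- The families of projections of irreducible words. -/
abbrev IrredFamily (Γ : SimpleGraph V) : Type _ :=
  {F : Family Γ // ∃ w, Irred Γ w ∧ family Γ w = F}

theorem irred_act (x : V × Bool) {F : Family Γ} (h : ∃ w, Irred Γ w ∧ family Γ w = F) :
    ∃ w, Irred Γ w ∧ family Γ w = F.act x := by
  obtain ⟨w, hw, rfl⟩ := h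
  by_cases hh : Heads Γ (invLetter x) w
  · obtain ⟨q, r, rfl, hq⟩ := hh.exists_split
    exact ⟨q ++ r, hw.erase hq, (act_family_of_split (x := x) hq).symm⟩
  · exact ⟨x :: w, ⟨hw, hh⟩, (act_family_of_not_heads hh).symm⟩

/-- Irreducibility is essential: otherwise, after a cancellation, the inverse letter could cancel
again instead of being put back. -/
theorem act_invLetter_act (x : V × Bool) {F : Family Γ}
    (h : ∃ w, Irred Γ w ∧ family Γ w = F) : (F.act x).act (invLetter x) = F := by
  obtain ⟨w, hw, rfl⟩ := h
  by_cases hh : Heads Γ (invLetter x) w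
  · obtain ⟨q, r, rfl, hq⟩ := hh.exists_split
    -- Irreducibility at the cancelled letter says that `r` cannot begin with `x`; the letters of
    -- `q` are independent of `x` and change nothing.
    have hn : ¬ Heads Γ x (q ++ r) := by
      clear hh
      induction q with
      | nil => simpa using hw.2
      | cons y q ih =>
        intro h1
        refine ih (fun z hz => hq z (by simp [hz])) hw.1 fun u hu => ?_
        have hy := hq y (by simp)
        have h2 := h1 u hu
        rwa [List.cons_append, proj_cons, if_neg] at h2
        rintro (h3 | h3)
        · exact hy (Or.inl h3.symm)
        · exact hy (by rw [h3]; exact hu)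
    rw [act_family_of_split (x := x) hq, act_family_of_not_heads (by simpa using hn), family_eq_iff]
    intro v u hd
    exact (traceEq_move (x := invLetter x) r hq v u hd).symm
  · rw [act_family_of_not_heads hh]
    have := act_family_of_split (Γ := Γ) (x := invLetter x) (q := []) (r := w) (by simp)
    simpa using this

/-- The permutation of `IrredFamily Γ` given by a generator. -/
noncomputable def genPerm (Γ : SimpleGraph V) (v : V) : Equiv.Perm (IrredFamily Γ) where
  toFun F := ⟨F.1.act (v, true), irred_act _ F.2⟩
  invFun F := ⟨F.1.act (v, false), irred_act _ F.2⟩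
  left_inv F := Subtype.ext (act_invLetter_act (v, true) F.2)
  right_inv F := Subtype.ext (act_invLetter_act (v, false) F.2)

/-- The action of `G(Γ)` on `IrredFamily Γ`. -/
noncomputable def toPerm (Γ : SimpleGraph V) : OppRAAG Γ →* Equiv.Perm (IrredFamily Γ) :=
  PresentedGroup.toGroup (f := genPerm Γ) (by
    rintro r ⟨v, u, hadj, rfl⟩
    rw [SimpleGraph.compl_adj] at hadj
    have hd : ¬ Dep Γ v u := fun h => h.elim hadj.1 hadj.2
    simp only [map_mul, map_inv, FreeGroup.lift_apply_of]
    rw [mul_inv_eq_one, mul_inv_eq_iff_eq_mul]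
    refine Equiv.ext fun F => ?_
    exact Subtype.ext (Family.act_comm (x := (v, true)) (y := (u, true)) hd F.1))

theorem toPerm_letter (x : V × Bool) (F : IrredFamily Γ) :
    (toPerm Γ (letter Γ x) F).1 = F.1.act x := by
  have h1 : ∀ v, toPerm Γ (gen Γ v) = genPerm Γ v := fun v => PresentedGroup.toGroup.of _
  obtain ⟨v, b⟩ := x
  cases b
  · simp only [letter, map_inv, h1, Bool.false_eq_true, if_false]; rfl
  · simp only [letter, h1, if_true]; rfl

theorem toPerm_ofWord {w : List (V × Bool)} (hw : Irred Γ w) :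
    (toPerm Γ (ofWord Γ w) ⟨family Γ [], [], irred_nil, rfl⟩).1 = family Γ w := by
  induction w with
  | nil => rw [ofWord_nil, map_one]; rfl
  | cons x w ih =>
    rw [ofWord_cons, map_mul, Equiv.Perm.mul_apply, toPerm_letter, ih hw.1,
      act_family_of_not_heads hw.2]

/-- An irreducible word acts on the empty family without any cancellation, so its projections can be
read off from the group element. -/
theorem Irred.traceEq {w w' : List (V × Bool)} (hw : Irred Γ w) (hw' : Irred Γ w')
    (h : ofWord Γ w = ofWord Γ w') : TraceEq Γ w w' := by
  rw [← family_eq_iff, ← toPerm_ofWord hw, ← toPerm_ofWord hw', h]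

end

/-! ### Powers, letter counts and prefixes of a trace -/

section

variable {V : Type*} {Γ : SimpleGraph V}

/-- The `n`-th power of a word. -/
def wpow (w : List (V × Bool)) (n : ℕ) : List (V × Bool) := (List.replicate n w).flatten

@[simp] theorem wpow_zero (w : List (V × Bool)) : wpow w 0 = [] := rfl

theorem wpow_succ (w : List (V × Bool)) (n : ℕ) : wpow w (n + 1) = w ++ wpow w n := by
  simp [wpow, List.replicate_succ]

theorem wpow_add (w : List (V × Bool)) (m n : ℕ) : wpow w (m + n) = wpow w m ++ wpow w n := by
  simp [wpow, ← List.flatten_append]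

theorem ofWord_wpow (w : List (V × Bool)) (n : ℕ) : ofWord Γ (wpow w n) = ofWord Γ w ^ n := by
  induction n with
  | zero => simp
  | succ n ih => rw [wpow_succ, ofWord_append, ih, pow_succ']

theorem length_wpow (w : List (V × Bool)) (n : ℕ) : (wpow w n).length = n * w.length := by
  simp [wpow]

/-- Euclid's algorithm: the shorter word is a prefix of the longer one, and the remainder still
commutes with it. -/
theorem countP_mul_countP_of_append_comm {α : Type*} (p q : α → Bool) :
    ∀ x y : List α, x ++ y = y ++ x → x.countP p * y.countP q = y.countP p * x.countP q := by
  suffices h : ∀ (n : ℕ) (x y : List α), x.length + y.length ≤ n → x.length ≤ y.length →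
      x ++ y = y ++ x → x.countP p * y.countP q = y.countP p * x.countP q by
    intro x y hxy
    rcases le_total x.length y.length with hl | hl
    · exact h _ x y le_rfl hl hxy
    · exact (h _ y x le_rfl hl hxy.symm).symm
  intro n
  induction n with
  | zero =>
    intro x y hn _ _
    have : x = [] := List.eq_nil_of_length_eq_zero (by omega)
    simp [this]
  | succ n ih =>
    intro x y hn hl hxy
    rcases eq_or_ne x [] with rfl | hx
    · simp
    have hpre : x <+: y := List.prefix_of_prefix_length_le (List.prefix_append x y)
      (hxy ▸ List.prefix_append y x) hl
    obtain ⟨z, rfl⟩ := hpre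
    have hz : x ++ z = z ++ x := by
      rw [List.append_assoc] at hxy
      exact List.append_cancel_left hxy
    have hpos := List.length_pos_iff.2 hx
    rw [List.length_append] at hn
    have key : x.countP p * z.countP q = z.countP p * x.countP q := by
      rcases le_total x.length z.length with h1 | h1
      · exact ih x z (by omega) h1 hz
      · exact (ih z x (by omega) h1 hz.symm).symm
    rw [List.countP_append, List.countP_append]
    linear_combination key

theorem wpow_append_comm {x y : List (V × Bool)} (h : x ++ y = y ++ x) (m n : ℕ) :
    wpow x m ++ wpow y n = wpow y n ++ wpow x m := by
  have h1 : ∀ m, wpow x m ++ y = y ++ wpow x m := by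
    intro m
    induction m with
    | zero => simp
    | succ m ih => rw [wpow_succ, List.append_assoc, ih, ← List.append_assoc, h, List.append_assoc]
  induction n with
  | zero => simp
  | succ n ih => rw [wpow_succ, ← List.append_assoc, h1, List.append_assoc, ih, List.append_assoc]

variable [DecidableEq V]

/-- The number of letters at the vertex `v`. -/
def cnt (v : V) (w : List (V × Bool)) : ℕ := w.countP fun x => x.1 = v

@[simp] theorem cnt_nil (v : V) : cnt v [] = 0 := rfl

theorem cnt_cons (v : V) (x : V × Bool) (w : List (V × Bool)) :
    cnt v (x :: w) = cnt v w + if x.1 = v then 1 else 0 := by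
  simp [cnt, List.countP_cons]

@[simp] theorem cnt_append (v : V) (w w' : List (V × Bool)) :
    cnt v (w ++ w') = cnt v w + cnt v w' := by
  simp [cnt]

@[simp] theorem cnt_wpow (v : V) (w : List (V × Bool)) (n : ℕ) :
    cnt v (wpow w n) = n * cnt v w := by
  induction n with
  | zero => simp
  | succ n ih => rw [wpow_succ, cnt_append, ih]; ring

theorem proj_wpow (v u : V) (w : List (V × Bool)) (n : ℕ) :
    proj v u (wpow w n) = wpow (proj v u w) n := by
  induction n with
  | zero => simp
  | succ n ih => rw [wpow_succ, wpow_succ, proj_append, ih]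

theorem cnt_pos_iff {v : V} {w : List (V × Bool)} : 0 < cnt v w ↔ ∃ b, (v, b) ∈ w := by
  simp only [cnt, List.countP_pos_iff, decide_eq_true_eq]
  constructor
  · rintro ⟨⟨_, b⟩, h, rfl⟩
    exact ⟨b, h⟩
  · rintro ⟨b, h⟩
    exact ⟨_, h, rfl⟩

theorem sum_cnt [Fintype V] (w : List (V × Bool)) : ∑ v, cnt v w = w.length := by
  induction w with
  | nil => simp
  | cons x w ih => simp [cnt_cons, Finset.sum_add_distrib, ih]

theorem cnt_proj_left (v u : V) (w : List (V × Bool)) : cnt v (proj v u w) = cnt v w := by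
  simp only [cnt, proj, List.countP_filter]
  congr 1
  funext x
  by_cases h : x.1 = v <;> simp [h]

theorem cnt_proj_right (v u : V) (w : List (V × Bool)) : cnt u (proj v u w) = cnt u w := by
  rw [proj_comm, cnt_proj_left]

theorem length_proj (v u : V) (w : List (V × Bool)) :
    (proj v u w).length = if v = u then cnt v w else cnt v w + cnt u w := by
  induction w with
  | nil => simp
  | cons x w ih =>
    rw [proj_cons, cnt_cons, cnt_cons]
    split_ifs at ih ⊢ <;> simp_all <;> omega

theorem TraceEq.cnt_eq {w w' : List (V × Bool)} (h : TraceEq Γ w w') (v : V) :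
    cnt v w = cnt v w' := by
  rw [← cnt_proj_left v v, h v v (.refl _), cnt_proj_left]

theorem TraceEq.symm {w w' : List (V × Bool)} (h : TraceEq Γ w w') : TraceEq Γ w' w :=
  fun v u hd => (h v u hd).symm

theorem TraceEq.trans {w w' w'' : List (V × Bool)} (h : TraceEq Γ w w') (h' : TraceEq Γ w' w'') :
    TraceEq Γ w w'' := fun v u hd => (h v u hd).trans (h' v u hd)

theorem Pre.trans {w w' w'' : List (V × Bool)} (h : Pre Γ w w') (h' : Pre Γ w' w'') :
    Pre Γ w w'' := fun v u hd => (h v u hd).trans (h' v u hd)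

theorem Pre.append_right {w w' : List (V × Bool)} (h : Pre Γ (w ++ w') w'') : Pre Γ w w'' :=
  fun v u hd => (by simp : proj v u w <+: proj v u (w ++ w')).trans (h v u hd)

theorem pre_append_append_iff {w p q : List (V × Bool)} :
    Pre Γ (w ++ p) (w ++ q) ↔ Pre Γ p q := by
  simp only [Pre, proj_append, List.prefix_append_right_inj]

/-- Two prefixes of the same word whose counts are comparable are comparable. -/
theorem Pre.of_cnt_le {p q w : List (V × Bool)} (hp : Pre Γ p w) (hq : Pre Γ q w)
    (h : ∀ v, cnt v p ≤ cnt v q) : Pre Γ p q := by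
  intro v u hd
  refine List.prefix_of_prefix_length_le (hp v u hd) (hq v u hd) ?_
  rw [length_proj, length_proj]
  have := h v
  have := h u
  split_ifs <;> omega

theorem Pre.traceEq_of_cnt_eq {p q w : List (V × Bool)} (hp : Pre Γ p w) (hq : Pre Γ q w)
    (h : ∀ v, cnt v p = cnt v q) : TraceEq Γ p q := fun v u hd =>
  (hp.of_cnt_le hq (fun v => (h v).le) v u hd).eq_of_length (by simp only [length_proj, h])

/-- The projections to `v` and `u` are prefixes of one word, hence nested; the strict inequality at
`v` decides the direction. -/
theorem Pre.cnt_le_of_cnt_lt {p q w : List (V × Bool)} (hp : Pre Γ p w) (hq : Pre Γ q w)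
    {v u : V} (hd : Dep Γ v u) (h : cnt v p < cnt v q) : cnt u p ≤ cnt u q := by
  rcases List.prefix_or_prefix_of_prefix (hp v u hd) (hq v u hd) with h1 | h1
  · rw [← cnt_proj_right v u, ← cnt_proj_right v u q]
    exact h1.sublist.countP_le
  · have : cnt v (proj v u q) ≤ cnt v (proj v u p) := h1.sublist.countP_le
    rw [cnt_proj_left, cnt_proj_left] at this
    omega

/-- Keep the first `ξ v` letters at each vertex `v`. -/
def cutWord (ξ : V → ℕ) : List (V × Bool) → List (V × Bool)
  | [] => []
  | x :: w =>
    if 0 < ξ x.1 then x :: cutWord (Function.update ξ x.1 (ξ x.1 - 1)) w else cutWord ξ w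

theorem cutWord_congr {ξ ξ' : V → ℕ} {w : List (V × Bool)} (h : ∀ x ∈ w, ξ x.1 = ξ' x.1) :
    cutWord ξ w = cutWord ξ' w := by
  induction w generalizing ξ ξ' with
  | nil => rfl
  | cons x w ih =>
    rw [cutWord, cutWord, h x (by simp), ih fun y hy => h y (by simp [hy]),
      ih (ξ := Function.update ξ _ _) (ξ' := Function.update ξ' x.1 (ξ' x.1 - 1))]
    intro y hy
    by_cases hyx : y.1 = x.1
    · simp [hyx]
    · simp [hyx, h y (by simp [hy])]

/-- Whether a letter is kept depends only on the earlier letters at its own vertex. -/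
theorem proj_cutWord (v u : V) (ξ : V → ℕ) (w : List (V × Bool)) :
    proj v u (cutWord ξ w) = cutWord ξ (proj v u w) := by
  induction w generalizing ξ with
  | nil => rfl
  | cons x w ih =>
    rw [cutWord, proj_cons]
    by_cases h : x.1 = v ∨ x.1 = u
    · rw [if_pos h, cutWord]
      split_ifs
      · rw [proj_cons, if_pos h, ih]
      · exact ih _
    · rw [if_neg h]
      split_ifs
      · rw [proj_cons, if_neg h, ih]
        refine cutWord_congr fun y hy => Function.update_of_ne ?_ _ _
        rintro hyx
        simp only [proj, List.mem_filter, decide_eq_true_eq, hyx] at hy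
        exact h hy.2
      · exact ih _

theorem cutWord_append {ξ : V → ℕ} {p q : List (V × Bool)}
    (h : ∀ x ∈ p ++ q, ξ x.1 = cnt x.1 p) : cutWord ξ (p ++ q) = p := by
  induction p generalizing ξ with
  | nil =>
    induction q with
    | nil => rfl
    | cons x q ih =>
      rw [List.nil_append, cutWord, if_neg (by simp [h x (by simp)])]
      exact ih fun y hy => h y (by simp at hy; simp [hy])
  | cons x p ih =>
    have hx := h x (by simp)
    rw [cnt_cons, if_pos rfl] at hx
    rw [List.cons_append, cutWord, if_pos (by omega), ih]
    intro y hy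
    have hy' := h y (List.mem_cons_of_mem _ hy)
    rw [cnt_cons] at hy'
    by_cases hyx : y.1 = x.1
    · simp [hyx, hx]
    · rw [Function.update_of_ne hyx, hy', if_neg (Ne.symm hyx), add_zero]

/-- Any two prefixes have a join, whose counts are the maxima of the counts. -/
theorem Pre.exists_join {p q w : List (V × Bool)} (hp : Pre Γ p w) (hq : Pre Γ q w) :
    ∃ d, Pre Γ d w ∧ ∀ v, cnt v d = max (cnt v p) (cnt v q) := by
  -- On each dependent pair one of the two projections contains the other, and cutting at the maxima
  -- returns the larger one.
  have key : ∀ v u, Dep Γ v u → ∃ r, r <+: proj v u w ∧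
      cutWord (fun v => max (cnt v p) (cnt v q)) (proj v u w) = r ∧
      cnt v r = max (cnt v p) (cnt v q) := by
    intro v u hd
    have aux : ∀ {p q : List (V × Bool)}, Pre Γ q w → proj v u p <+: proj v u q →
        cutWord (fun v => max (cnt v p) (cnt v q)) (proj v u w) = proj v u q ∧
        cnt v (proj v u q) = max (cnt v p) (cnt v q) := by
      intro p q hq hpq
      have hv : cnt v p ≤ cnt v q := by
        rw [← cnt_proj_left v u, ← cnt_proj_left v u q]
        exact hpq.sublist.countP_le
      have hu : cnt u p ≤ cnt u q := by
        rw [← cnt_proj_right v u, ← cnt_proj_right v u q]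
        exact hpq.sublist.countP_le
      refine ⟨?_, by rw [cnt_proj_left, max_eq_right hv]⟩
      obtain ⟨t, ht⟩ := hq v u hd
      rw [← ht]
      refine cutWord_append fun x hx => ?_
      rw [ht] at hx
      simp only [proj, List.mem_filter, decide_eq_true_eq] at hx
      rcases hx.2 with h | h
      · rw [h, cnt_proj_left, max_eq_right hv]
      · rw [h, cnt_proj_right, max_eq_right hu]
    rcases List.prefix_or_prefix_of_prefix (hp v u hd) (hq v u hd) with h | h
    · exact ⟨_, hq v u hd, aux hq h⟩
    · have := aux hp h
      simp only [max_comm (cnt _ q)] at this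
      exact ⟨_, hp v u hd, this⟩
  refine ⟨cutWord (fun v => max (cnt v p) (cnt v q)) w, fun v u hd => ?_, fun v => ?_⟩
  · obtain ⟨r, h1, h2, -⟩ := key v u hd
    rwa [proj_cutWord, h2]
  · obtain ⟨r, -, h2, h3⟩ := key v v (.refl _)
    rw [← cnt_proj_left v v, proj_cutWord, h2, h3]

/-- Shifting a prefix of `w` by one period of a periodic part `a · gⁿ` of `w`. -/
theorem Pre.exists_shift {a g d w : List (V × Bool)} {n : ℕ} (hw : Pre Γ (a ++ wpow g n) w)
    (hd : Pre Γ d w) (h1 : ∀ v, cnt v a ≤ cnt v d)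
    (h2 : ∀ v, cnt v d + cnt v g ≤ cnt v a + n * cnt v g) (hn : 0 < n) :
    ∃ x y, TraceEq Γ (a ++ x) d ∧ TraceEq Γ (d ++ y) (a ++ g ++ x) ∧ Pre Γ (a ++ g ++ x) w := by
  obtain ⟨n, rfl⟩ : ∃ m, n = m + 1 := ⟨n - 1, by omega⟩
  obtain ⟨x, hx⟩ := (hw.append_right.of_cnt_le hd h1).exists_append
  have ha : Pre Γ (a ++ wpow g n) (a ++ wpow g (n + 1)) := by
    rw [wpow_add, ← List.append_assoc]
    intro v u _
    simp
  have h3 : Pre Γ d (a ++ wpow g n) := hd.of_cnt_le (ha.trans hw) fun v => by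
    have := h2 v
    rw [cnt_append, cnt_wpow]
    linarith
  have h4 : Pre Γ x (wpow g n) := pre_append_append_iff.1 (hx.pre.trans h3)
  have h5 : Pre Γ (a ++ g ++ x) w := by
    refine Pre.trans ?_ hw
    rwa [wpow_succ, ← List.append_assoc, pre_append_append_iff]
  have h6 : Pre Γ d (a ++ g ++ x) := hd.of_cnt_le h5 fun v => by
    rw [← hx.cnt_eq]
    simp only [cnt_append]
    omega
  obtain ⟨y, hy⟩ := h6.exists_append
  exact ⟨x, y, hx, hy, h5⟩

end

/-! ### Comparison of letter counts and the overlap estimate -/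

section

variable {V : Type*} {Γ : SimpleGraph V}

/-- If `ξ` and the vectors `α + j γ` come from prefixes of one word, then going along a walk of
length `l` in the support of `γ` loses at most `l` periods. -/
theorem le_of_walk {S : Set V} {α γ ξ : V → ℕ} {n : ℕ} (hS : ∀ v, v ∈ S ↔ 0 < γ v)
    (hcomp : ∀ j ≤ n, ∀ v u, Dep Γ v u → α v + j * γ v < ξ v → α u + j * γ u ≤ ξ u)
    {v u : S} (p : (Γ.induce S).Walk v u) {j : ℕ} (hj : j + p.length ≤ n)
    (h : α v + (j + p.length) * γ v ≤ ξ v) : α u + j * γ u ≤ ξ u := by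
  induction p with
  | nil => simpa using h
  | @cons v w u hvw p ih =>
    rw [SimpleGraph.Walk.length_cons] at hj h
    refine ih (by omega) (hcomp _ (by omega) v w (Or.inr hvw) (lt_of_lt_of_le ?_ h))
    have := (hS v).1 v.2
    rw [← add_assoc, add_mul (j + p.length)]
    omega

/-- A prefix that contains a letter after the `j`-th period contains all earlier periods up to a
loss of less than `|V|` periods. -/
theorem le_of_exceeds [Fintype V] {S : Set V} {α γ ξ : V → ℕ} {n : ℕ}
    (hS : ∀ v, v ∈ S ↔ 0 < γ v)
    (hcomp : ∀ j ≤ n, ∀ v u, Dep Γ v u → α v + j * γ v < ξ v → α u + j * γ u ≤ ξ u)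
    (hconn : (Γ.induce S).Connected) (hdom : ∀ v, ∃ w ∈ S, Dep Γ v w) {i j : ℕ}
    (hij : j + 1 = i + Fintype.card V) (hj : j ≤ n) {v : V} (hv : α v + j * γ v < ξ v) (u : V) :
    α u + i * γ u ≤ ξ u := by
  classical
  obtain ⟨v₀, hv₀, hd⟩ := hdom v
  have h0 := hcomp j hj v v₀ hd hv
  have hcard : ∀ w : S, ∃ p : (Γ.induce S).Walk ⟨v₀, hv₀⟩ w, p.length < Fintype.card S := by
    intro w
    obtain ⟨p, hp⟩ := (hconn ⟨v₀, hv₀⟩ w).exists_isPath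
    exact ⟨p, hp.length_lt⟩
  by_cases hu : u ∈ S
  · obtain ⟨p, hp⟩ := hcard ⟨u, hu⟩
    have hle := set_fintype_card_le_univ S
    obtain ⟨k, hk⟩ : ∃ k, j = k + p.length := ⟨j - p.length, by omega⟩
    rw [hk] at h0 hj
    have h1 := le_of_walk hS hcomp p hj h0
    have : i * γ u ≤ k * γ u := Nat.mul_le_mul_right _ (by omega)
    simp only at h1
    omega
  · obtain ⟨w, hw, hd'⟩ := hdom u
    obtain ⟨p, hp⟩ := hcard ⟨w, hw⟩
    -- Leaving the support needs a strict inequality, which costs one more period; it is available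
    -- because `S` omits `u`.
    have hlt : Fintype.card S < Fintype.card V := Fintype.card_subtype_lt hu
    obtain ⟨k, hk⟩ : ∃ k, j = k + 1 + p.length := ⟨j - p.length - 1, by omega⟩
    rw [hk] at h0 hj
    have h1 := le_of_walk hS hcomp p hj h0
    have hpos := (hS w).1 hw
    have hzero : γ u = 0 := by
      have := (hS u).not.1 hu
      omega
    have h2 := hcomp k (by omega) w u hd'.symm (by
      simp only at h1
      rw [add_mul] at h1
      omega)
    simpa [hzero] using h2

/-- An excess at one vertex would give `ξ ≥ α + i γ` everywhere, strictly at that vertex, against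
the sums. -/
theorem le_of_sum_le [Fintype V] {S : Set V} {α γ ξ : V → ℕ} {n : ℕ}
    (hS : ∀ v, v ∈ S ↔ 0 < γ v)
    (hcomp : ∀ j ≤ n, ∀ v u, Dep Γ v u → α v + j * γ v < ξ v → α u + j * γ u ≤ ξ u)
    (hconn : (Γ.induce S).Connected) (hdom : ∀ v, ∃ w ∈ S, Dep Γ v w) {i j : ℕ}
    (hij : j + 1 = i + Fintype.card V) (hj : j ≤ n)
    (hsum : ∑ v, ξ v ≤ ∑ v, α v + i * ∑ v, γ v) (v : V) : ξ v ≤ α v + j * γ v := by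
  by_contra! hv
  have h1 := le_of_exceeds hS hcomp hconn hdom hij hj hv
  have hcard : 0 < Fintype.card V := Fintype.card_pos_iff.2 ⟨v⟩
  have h2 : i * γ v ≤ j * γ v := Nat.mul_le_mul_right _ (by omega)
  have := Finset.sum_lt_sum (fun u (_ : u ∈ Finset.univ) => h1 u) ⟨v, Finset.mem_univ v, by omega⟩
  rw [Finset.sum_add_distrib, ← Finset.mul_sum] at this
  omega

theorem le_of_le_sum [Fintype V] {S : Set V} {α γ ξ : V → ℕ} {n : ℕ}
    (hS : ∀ v, v ∈ S ↔ 0 < γ v)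
    (hcomp : ∀ j ≤ n, ∀ v u, Dep Γ v u → α v + j * γ v < ξ v → α u + j * γ u ≤ ξ u)
    (hconn : (Γ.induce S).Connected) (hdom : ∀ v, ∃ w ∈ S, Dep Γ v w) {i j : ℕ}
    (hij : j + 1 = i + Fintype.card V) (hj : j ≤ n)
    (hsum : ∑ v, α v + j * ∑ v, γ v ≤ ∑ v, ξ v) (v : V) : α v + i * γ v ≤ ξ v := by
  by_cases h : ∃ u, α u + j * γ u < ξ u
  · obtain ⟨u, hu⟩ := h
    exact le_of_exceeds hS hcomp hconn hdom hij hj hu v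
  · push Not at h
    have hcard : 0 < Fintype.card V := Fintype.card_pos_iff.2 ⟨v⟩
    have h2 : i * γ v ≤ j * γ v := Nat.mul_le_mul_right _ (by omega)
    by_contra! hv
    have := Finset.sum_lt_sum (fun u (_ : u ∈ Finset.univ) => h u) ⟨v, Finset.mem_univ v, by omega⟩
    rw [Finset.sum_add_distrib, ← Finset.mul_sum] at this
    omega

/-- The estimate of the overlap of two periodic parts of one word. -/
theorem overlap [Fintype V] {S : Set V} {α γ β δ : V → ℕ} {n₁ n₂ b₁ b₂ L M : ℕ}
    (hS : ∀ v, v ∈ S ↔ 0 < γ v) (hconn : (Γ.induce S).Connected)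
    (hdom : ∀ v, ∃ w ∈ S, Dep Γ v w)
    (hcomp : ∀ m ≤ n₂, ∀ j ≤ n₁, ∀ v u, Dep Γ v u →
      α v + j * γ v < β v + m * δ v → α u + j * γ u ≤ β u + m * δ u)
    (hL₁ : ∑ v, α v + n₁ * ∑ v, γ v + b₁ = L) (hL₂ : ∑ v, β v + n₂ * ∑ v, δ v + b₂ = L)
    (hγ : ∑ v, γ v ≤ M) (hδ : ∑ v, δ v ≤ M) (hδ0 : 0 < ∑ v, δ v)
    (h₁₁ : ∑ v, α v + b₁ + (2 * Fintype.card V + 1) * M ≤ L)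
    (h₁₂ : ∑ v, α v + b₂ + (2 * Fintype.card V + 1) * M ≤ L)
    (h₂₁ : ∑ v, β v + b₁ + (2 * Fintype.card V + 1) * M ≤ L)
    (h₂₂ : ∑ v, β v + b₂ + (2 * Fintype.card V + 1) * M ≤ L) (v : V) :
    β v + δ v ≤ α v + (n₁ - 1) * γ v ∧ δ v ≤ (n₁ - 1) * γ v := by
  have hcard : 0 < Fintype.card V := Fintype.card_pos_iff.2 ⟨v⟩
  obtain ⟨k, hk⟩ : ∃ k, Fintype.card V = k + 1 := ⟨Fintype.card V - 1, by omega⟩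
  rw [hk] at h₁₁ h₁₂ h₂₁ h₂₂
  have hγ0 : 0 < ∑ v, γ v := by
    obtain ⟨w, hw, -⟩ := hdom v
    exact lt_of_lt_of_le ((hS w).1 hw) (Finset.single_le_sum (f := γ) (by simp) (Finset.mem_univ w))
  set a₁ := ∑ v, α v
  set a₂ := ∑ v, β v
  set g₁ := ∑ v, γ v
  set g₂ := ∑ v, δ v
  have hkM : k * g₁ ≤ k * M := Nat.mul_le_mul_left _ hγ
  have hn₁ : k + 1 ≤ n₁ := by
    refine le_of_mul_le_mul_right ?_ hγ0
    nlinarith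
  obtain ⟨i, rfl⟩ : ∃ i, n₁ = i + (k + 1) := ⟨n₁ - (k + 1), by omega⟩
  have hup : ∀ m ≤ n₂, a₂ + m * g₂ ≤ a₁ + i * g₁ →
      β v + m * δ v ≤ α v + (i + (k + 1) - 1) * γ v := by
    intro m hm hsum
    refine le_of_sum_le (Γ := Γ) (ξ := fun v => β v + m * δ v) hS (hcomp m hm) hconn hdom
      (i := i) (by omega) (by omega) ?_ v
    rw [Finset.sum_add_distrib, ← Finset.mul_sum]
    exact hsum
  have hlow : ∀ m ≤ n₂, a₁ + k * g₁ ≤ a₂ + m * g₂ → α v ≤ β v + m * δ v := by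
    intro m hm hsum
    have := le_of_le_sum (Γ := Γ) (ξ := fun v => β v + m * δ v) hS (hcomp m hm) hconn hdom
      (i := 0) (j := k) (by omega) (by omega)
      (by rw [Finset.sum_add_distrib, ← Finset.mul_sum]; exact hsum) v
    simpa using this
  have hn₂ : 1 ≤ n₂ := by
    by_contra! h
    obtain rfl : n₂ = 0 := by omega
    nlinarith
  have hA : β v + δ v ≤ α v + (i + (k + 1) - 1) * γ v := by
    simpa using hup 1 hn₂ (by nlinarith)
  refine ⟨hA, ?_⟩
  -- Take the least `m` for which `β + m δ` is long enough to lie above `α`. By minimality `β + (m +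
  -- 1) δ` is shorter than `α + k γ` plus two periods `δ`, so it still lies below `α + (n₁ - 1) γ`;
  -- subtracting leaves `δ`. The cost is `k + 2` periods here and `k + 1` in `hup`, in total `2|V| +
  -- 1`.
  have hex : ∃ m, a₁ + k * g₁ ≤ a₂ + m * g₂ := ⟨n₂, by nlinarith⟩
  obtain ⟨m, hm, hmin⟩ : ∃ m, a₁ + k * g₁ ≤ a₂ + m * g₂ ∧
      ∀ m', m = m' + 1 → a₂ + m' * g₂ < a₁ + k * g₁ := by
    classical
    refine ⟨Nat.find hex, Nat.find_spec hex, fun m' hm' => ?_⟩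
    exact not_le.1 (Nat.find_min hex (m := m') (by omega))
  rcases m with _ | m
  · have := hlow 0 (by omega) hm
    simp only [zero_mul, add_zero] at this
    omega
  · have hlt := hmin m rfl
    have hm2 : m + 2 ≤ n₂ := by
      refine le_of_mul_le_mul_right ?_ hδ0
      nlinarith
    have h1 := hlow (m + 1) (by omega) hm
    have h2 := hup (m + 2) hm2 (by nlinarith)
    have h3 : (m + 2) * δ v = (m + 1) * δ v + δ v := by ring
    omega

/-- On the support `γ` is positive and can be cancelled, so the ratio passes along edges, and by one
last step to vertices outside. -/
theorem proportional_of_connected {S : Set V} {γ δ : V → ℕ} (hS : ∀ v, v ∈ S ↔ 0 < γ v)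
    (hconn : (Γ.induce S).Connected) (hdom : ∀ v, ∃ w ∈ S, Dep Γ v w)
    (h : ∀ v u, Dep Γ v u → γ v * δ u = δ v * γ u) {v₀ : V} (hv₀ : v₀ ∈ S) (v : V) :
    γ v₀ * δ v = δ v₀ * γ v := by
  have step : ∀ u w, u ∈ S → Dep Γ u w → γ v₀ * δ u = δ v₀ * γ u → γ v₀ * δ w = δ v₀ * γ w := by
    intro u w hu hd h1
    have h2 := h u w hd
    refine Nat.eq_of_mul_eq_mul_left ((hS u).1 hu) ?_
    linear_combination γ v₀ * h2 + γ w * h1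
  have walk : ∀ {u w : S}, (Γ.induce S).Walk u w → γ v₀ * δ u = δ v₀ * γ u →
      γ v₀ * δ w = δ v₀ * γ w := by
    intro u w p
    induction p with
    | nil => exact id
    | @cons u w _ hadj _ ih => exact fun h1 => ih (step u w u.2 (Or.inr hadj) h1)
  obtain ⟨w, hw, hd⟩ := hdom v
  obtain ⟨p⟩ := hconn ⟨v₀, hv₀⟩ ⟨w, hw⟩
  exact step w v hw hd.symm (walk p (mul_comm _ _))

end

/-! ### Common roots of commuting elements -/

theorem exists_pow_eq_of_commute {G : Type*} [Group G] {x y : G} (h : Commute x y) {e c : ℕ}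
    (hec : e.Coprime c) (hxy : x ^ e = y ^ c) : ∃ u : G, u ^ c = x ∧ u ^ e = y := by
  -- With Bézout coefficients `e s + c t = 1`, the common root is `xᵗ yˢ`.
  have hb : (e : ℤ) * e.gcdA c + c * e.gcdB c = 1 := by
    rw [← Nat.gcd_eq_gcd_ab, hec]; rfl
  generalize e.gcdA c = s at hb
  generalize e.gcdB c = t at hb
  have hxy' : x ^ (e : ℤ) = y ^ (c : ℤ) := by exact_mod_cast hxy
  have hc : Commute (x ^ t) (y ^ s) := (h.zpow_left t).zpow_right s
  refine ⟨x ^ t * y ^ s, ?_, ?_⟩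
  · rw [hc.mul_pow, ← zpow_natCast, ← zpow_natCast, ← zpow_mul, ← zpow_mul, mul_comm s, zpow_mul y,
      ← hxy', ← zpow_mul, ← zpow_add, mul_comm t, add_comm, hb, zpow_one]
  · rw [hc.mul_pow, ← zpow_natCast, ← zpow_natCast, ← zpow_mul, ← zpow_mul, mul_comm t, zpow_mul x,
      hxy', ← zpow_mul, ← zpow_add, mul_comm s, add_comm, hb, zpow_one]

theorem IsPrimitiveElement.of_conj {G : Type*} [Group G] {g x : G} (d : G)
    (hg : IsPrimitiveElement g) (h : g * d = d * x) : IsPrimitiveElement x := by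
  obtain rfl : g = d * x * d⁻¹ := by rw [← h]; group
  refine ⟨fun hx => hg.1 (by rw [hx]; group), fun n hn u hu => hg.2 n hn (d * u * d⁻¹) ?_⟩
  rw [conj_pow, hu]

theorem IsPrimitiveElement.eq_of_pow_eq {G : Type*} [Group G] {x y : G}
    (hx : IsPrimitiveElement x) (hy : IsPrimitiveElement y) (h : Commute x y) {e c : ℕ}
    (he : 0 < e) (hc : 0 < c) (hec : e.Coprime c) (hxy : x ^ e = y ^ c) : x = y := by
  obtain ⟨u, hux, huy⟩ := exists_pow_eq_of_commute h hec hxy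
  have h1 : ¬ 2 ≤ c := fun h => hx.2 c h u hux.symm
  have h2 : ¬ 2 ≤ e := fun h => hy.2 e h u huy.symm
  obtain rfl : c = 1 := by omega
  obtain rfl : e = 1 := by omega
  simpa using hxy

/-! ### Reduced words and commuting periods -/

section

variable {V : Type*} {Γ : SimpleGraph V}

theorem wordLength_ofWord_le (w : List (V × Bool)) : wordLength (ofWord Γ w) ≤ w.length :=
  Nat.sInf_le ⟨w, rfl, rfl⟩

theorem exists_reducedWord (g : OppRAAG Γ) :
    ∃ w, IsReducedWord Γ w ∧ ofWord Γ w = g ∧ w.length = wordLength g := by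
  obtain ⟨w₀, h₀⟩ := ofWord_surjective Γ g
  obtain ⟨w, hw, hl⟩ := Nat.sInf_mem
    (s := {n : ℕ | ∃ w : List (V × Bool), ofWord Γ w = g ∧ w.length = n}) ⟨_, w₀, h₀, rfl⟩
  refine ⟨w, fun w' hw' => ?_, hw, hl⟩
  rw [hl]
  exact Nat.sInf_le ⟨w', hw'.trans hw, rfl⟩

theorem isReducedWord_of_length_eq {w : List (V × Bool)}
    (h : w.length = wordLength (ofWord Γ w)) : IsReducedWord Γ w := fun w' hw' => by
  rw [h, ← hw']
  exact wordLength_ofWord_le w'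

theorem IsReducedWord.of_eq {w w' : List (V × Bool)} (hw : IsReducedWord Γ w)
    (h : ofWord Γ w' = ofWord Γ w) (hl : w'.length = w.length) : IsReducedWord Γ w' :=
  fun w'' hw'' => hl ▸ hw w'' (hw''.trans h)

theorem IsReducedWord.factor {p q r : List (V × Bool)} (h : IsReducedWord Γ (p ++ q ++ r)) :
    IsReducedWord Γ q := fun q' hq' => by
  have := h (p ++ q' ++ r) (by simp only [ofWord_append, hq'])
  simp only [List.length_append] at this
  omega

/-- A quasi-root decomposition gives a reduced word of the corresponding form. -/
theorem IsQuasiRootDecomposition.exists_words {lam N : ℝ} {h a g b : OppRAAG Γ} {n : ℕ}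
    (hd : IsQuasiRootDecomposition lam N h a g n b) :
    ∃ A G B : List (V × Bool), IsReducedWord Γ G ∧ ofWord Γ A = a ∧ ofWord Γ G = g ∧
      A.length = wordLength a ∧ G.length = wordLength g ∧ B.length = wordLength b ∧
      h = a * g ^ n * b ∧
      IsReducedWord Γ (A ++ wpow G n ++ B) ∧ ofWord Γ (A ++ wpow G n ++ B) = h ∧
      wordLength h = wordLength a + n * wordLength g + wordLength b := by
  obtain ⟨⟨hprod, hlen⟩, -⟩ := hd
  obtain ⟨A, -, hA, hA'⟩ := exists_reducedWord a
  obtain ⟨G, hG0, hG, hG'⟩ := exists_reducedWord g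
  obtain ⟨B, -, hB, hB'⟩ := exists_reducedWord b
  have hh : h = a * g ^ n * b := by simpa [mul_assoc] using hprod
  have hl : wordLength h = wordLength a + n * wordLength g + wordLength b := by
    simpa [add_assoc] using hlen
  have hw : ofWord Γ (A ++ wpow G n ++ B) = h := by
    rw [ofWord_append, ofWord_append, ofWord_wpow, hA, hG, hB, hh]
  refine ⟨A, G, B, hG0, hA, hG, hA', hG', hB', hh, isReducedWord_of_length_eq ?_, hw, hl⟩
  rw [hw, hl, List.length_append, List.length_append, length_wpow, hA', hG', hB']

variable [DecidableEq V]

theorem mem_supp_iff {w : List (V × Bool)} (hw : IsReducedWord Γ w) (v : V) :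
    v ∈ supp (ofWord Γ w) ↔ 0 < cnt v w := by
  have hmem : ∀ w : List (V × Bool), ((v, true) ∈ w ∨ (v, false) ∈ w) ↔ 0 < cnt v w := by
    intro w
    rw [cnt_pos_iff, Bool.exists_bool, or_comm]
  constructor
  · rintro ⟨w', hr, he, hv⟩
    rw [← (hr.irred.traceEq hw.irred he).cnt_eq]
    exact (hmem w').1 hv
  · exact fun h => ⟨w, hw, rfl, (hmem w).2 h⟩

theorem supp_gen_subset (v : V) : supp (gen Γ v) ⊆ {v} := by
  have hirr : Irred Γ [(v, true)] := ⟨irred_nil, fun h => by simpa using h v (.refl _)⟩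
  have hgen : ofWord Γ [(v, true)] = gen Γ v := by simp [ofWord, letter]
  rintro u ⟨w, hr, he, hu⟩
  have h1 := (hr.irred.traceEq hirr (he.trans hgen.symm)).cnt_eq u
  have h2 : 0 < cnt u w := cnt_pos_iff.2 (hu.elim (fun h => ⟨_, h⟩) fun h => ⟨_, h⟩)
  rw [h1, cnt_pos_iff] at h2
  simpa using h2

/-- A vertex independent of the whole support would give a generator disjointly commuting with `g`.
-/
theorem IsStronglyNonSplit.exists_dep {g : OppRAAG Γ} (hg : IsStronglyNonSplit g) (v : V) :
    ∃ w ∈ supp g, Dep Γ v w := by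
  by_contra! h
  refine hg.2 ⟨v, Set.disjoint_left.2 fun u hu hug => ?_, fun u hu w hw => ?_⟩
  · obtain rfl := supp_gen_subset v hu
    exact h u hug (.refl _)
  · obtain rfl := supp_gen_subset v hu
    exact gen_commute (h w hw)

theorem TraceEq.length_eq [Fintype V] {w w' : List (V × Bool)} (h : TraceEq Γ w w') :
    w.length = w'.length := by
  rw [← sum_cnt, ← sum_cnt]
  exact Finset.sum_congr rfl fun v _ => h.cnt_eq v

theorem TraceEq.append_left {w w' : List (V × Bool)} (t : List (V × Bool))
    (h : TraceEq Γ w w') : TraceEq Γ (t ++ w) (t ++ w') := fun v u hd => by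
  rw [proj_append, proj_append, h v u hd]

theorem TraceEq.of_append_left {w w' t : List (V × Bool)}
    (h : TraceEq Γ (t ++ w) (t ++ w')) : TraceEq Γ w w' := fun v u hd => by
  have := h v u hd
  rwa [proj_append, proj_append, List.append_cancel_left_eq] at this

theorem Pre.isReducedWord [Fintype V] {p q w : List (V × Bool)} (h : Pre Γ (p ++ q) w)
    (hw : IsReducedWord Γ w) : IsReducedWord Γ q := by
  obtain ⟨t, ht⟩ := h.exists_append
  exact (hw.of_eq ht.ofWord_eq ht.length_eq).factor

/-- The shift by one period in terms of elements of the group. -/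
theorem Pre.exists_shift_mul {a g d w : List (V × Bool)} {n : ℕ}
    (hw : Pre Γ (a ++ wpow g n) w) (hd : Pre Γ d w) (h1 : ∀ v, cnt v a ≤ cnt v d)
    (h2 : ∀ v, cnt v d + cnt v g ≤ cnt v a + n * cnt v g) (hn : 0 < n) :
    ∃ y, Pre Γ (d ++ y) w ∧ (∀ v, cnt v y = cnt v g) ∧
      ofWord Γ a * ofWord Γ g * (ofWord Γ a)⁻¹ * ofWord Γ d = ofWord Γ d * ofWord Γ y := by
  obtain ⟨x, y, hx, hy, hp⟩ := hw.exists_shift hd h1 h2 hn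
  refine ⟨y, hy.pre.trans hp, fun v => ?_, ?_⟩
  · have h3 := hx.cnt_eq v
    have h4 := hy.cnt_eq v
    simp only [cnt_append] at h3 h4
    omega
  · have h3 := hx.ofWord_eq
    have h4 := hy.ofWord_eq
    rw [ofWord_append] at h3 h4
    rw [h4, ← h3, ofWord_append, ofWord_append]
    group

/-- Two periodic parts of a reduced word with a long overlap have commuting periods. -/
theorem exists_commuting_periods [Fintype V] {a₁ g₁ a₂ g₂ w : List (V × Bool)} {n₁ n₂ : ℕ}
    (hw : IsReducedWord Γ w) (hw₁ : Pre Γ (a₁ ++ wpow g₁ n₁) w)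
    (hw₂ : Pre Γ (a₂ ++ wpow g₂ n₂) w) (hn₁ : 0 < n₁) (hn₂ : 0 < n₂)
    (h₁ : ∀ v, cnt v a₁ + cnt v g₁ ≤ cnt v a₂ + (n₂ - 1) * cnt v g₂ ∧
      cnt v g₁ ≤ (n₂ - 1) * cnt v g₂)
    (h₂ : ∀ v, cnt v a₂ + cnt v g₂ ≤ cnt v a₁ + (n₁ - 1) * cnt v g₁ ∧
      cnt v g₂ ≤ (n₁ - 1) * cnt v g₁) :
    ∃ (d : OppRAAG Γ) (y₁ y₂ : List (V × Bool)), TraceEq Γ (y₁ ++ y₂) (y₂ ++ y₁) ∧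
      (∀ v, cnt v y₁ = cnt v g₁) ∧ (∀ v, cnt v y₂ = cnt v g₂) ∧
      ofWord Γ a₁ * ofWord Γ g₁ * (ofWord Γ a₁)⁻¹ * d = d * ofWord Γ y₁ ∧
      ofWord Γ a₂ * ofWord Γ g₂ * (ofWord Γ a₂)⁻¹ * d = d * ofWord Γ y₂ := by
  obtain ⟨d, hd, hcd⟩ := hw₁.append_right.exists_join hw₂.append_right
  obtain ⟨m₁, rfl⟩ : ∃ m, n₁ = m + 1 := ⟨n₁ - 1, by omega⟩
  obtain ⟨m₂, rfl⟩ : ∃ m, n₂ = m + 1 := ⟨n₂ - 1, by omega⟩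
  simp only [Nat.add_sub_cancel] at h₁ h₂
  obtain ⟨y₁, hp₁, hc₁, he₁⟩ := hw₁.exists_shift_mul hd (fun v => by rw [hcd]; omega)
    (fun v => by rw [hcd, add_mul]; have := h₂ v; omega) hn₁
  obtain ⟨y₂, hp₂, hc₂, he₂⟩ := hw₂.exists_shift_mul hd (fun v => by rw [hcd]; omega)
    (fun v => by rw [hcd, add_mul]; have := h₁ v; omega) hn₂
  -- Second shifts, closing a square over `d`. As `d` has the larger of the two counts, `d y₁` fits
  -- below the last period of `g₂` by both halves of `h₁`: one for each value of the maximum.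
  obtain ⟨z₂, hq₂, hc₂', he₂'⟩ := hw₂.exists_shift_mul hp₁
    (fun v => by rw [cnt_append, hcd]; omega)
    (fun v => by rw [cnt_append, hcd, hc₁, add_mul]; have := h₁ v; omega) hn₂
  obtain ⟨z₁, hq₁, hc₁', he₁'⟩ := hw₁.exists_shift_mul hp₂
    (fun v => by rw [cnt_append, hcd]; omega)
    (fun v => by rw [cnt_append, hcd, hc₂, add_mul]; have := h₂ v; omega) hn₁
  have hsq : TraceEq Γ (d ++ y₁ ++ z₂) (d ++ y₂ ++ z₁) := hq₂.traceEq_of_cnt_eq hq₁ fun v => by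
    simp only [cnt_append, hc₁, hc₂, hc₁', hc₂']
    ring
  have hgrp := hsq.ofWord_eq
  rw [ofWord_append _ z₂, ofWord_append _ z₁, ← he₁', ← he₂', ofWord_append, ofWord_append,
    ← he₁, ← he₂] at hgrp
  refine ⟨ofWord Γ d, y₁, y₂, ?_, hc₁, hc₂, he₁, he₂⟩
  rw [ofWord_append] at he₁' he₂'
  generalize ofWord Γ a₁ * ofWord Γ g₁ * (ofWord Γ a₁)⁻¹ = P₁ at *
  generalize ofWord Γ a₂ * ofWord Γ g₂ * (ofWord Γ a₂)⁻¹ = P₂ at *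
  -- Both ways around the square agree, so `P₁ P₂ d = P₂ P₁ d`, and opposite sides of the square are
  -- equal.
  have hz₁ : ofWord Γ z₁ = ofWord Γ y₁ := by
    refine mul_left_cancel (a := ofWord Γ d * ofWord Γ y₂) ?_
    rw [← he₁', ← he₂, ← hgrp, he₁, ← mul_assoc, he₂]
  have hz₂ : ofWord Γ z₂ = ofWord Γ y₂ := by
    refine mul_left_cancel (a := ofWord Γ d * ofWord Γ y₁) ?_
    rw [← he₂', ← he₁, hgrp, he₂, ← mul_assoc, he₁]
  have ht₁ := (hq₁.isReducedWord hw).irred.traceEq (hp₁.isReducedWord hw).irred hz₁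
  have ht₂ := (hq₂.isReducedWord hw).irred.traceEq (hp₂.isReducedWord hw).irred hz₂
  rw [List.append_assoc, List.append_assoc] at hsq
  exact ((ht₂.symm.append_left y₁).trans hsq.of_append_left).trans (ht₁.append_left y₂)

/-- Primitive commuting periods coincide. -/
theorem ofWord_eq_of_append_comm [Fintype V] {S : Set V} {y₁ y₂ : List (V × Bool)}
    (h : TraceEq Γ (y₁ ++ y₂) (y₂ ++ y₁)) (hS : ∀ v, v ∈ S ↔ 0 < cnt v y₁)
    (hconn : (Γ.induce S).Connected) (hdom : ∀ v, ∃ w ∈ S, Dep Γ v w)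
    (hp₁ : IsPrimitiveElement (ofWord Γ y₁)) (hp₂ : IsPrimitiveElement (ofWord Γ y₂)) :
    ofWord Γ y₁ = ofWord Γ y₂ := by
  have hcomm : ∀ v u, Dep Γ v u → proj v u y₁ ++ proj v u y₂ = proj v u y₂ ++ proj v u y₁ :=
    fun v u hd => by simpa using h v u hd
  obtain ⟨v₀, hv₀⟩ := hconn.nonempty
  have hpos := (hS v₀).1 hv₀
  have hprop : ∀ v, cnt v₀ y₁ * cnt v y₂ = cnt v₀ y₂ * cnt v y₁ := by
    refine proportional_of_connected hS hconn hdom (fun v u hd => ?_) hv₀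
    have := countP_mul_countP_of_append_comm (fun x => x.1 = v) (fun x => x.1 = u) _ _
      (hcomm v u hd)
    change cnt v (proj v u y₁) * cnt u (proj v u y₂) =
      cnt v (proj v u y₂) * cnt u (proj v u y₁) at this
    simpa only [cnt_proj_left, cnt_proj_right] using this
  have hpos₂ : 0 < cnt v₀ y₂ := by
    by_contra! h0
    have hnil : y₂.length = 0 := by
      rw [← sum_cnt]
      refine Finset.sum_eq_zero fun v _ => ?_
      have := hprop v
      rw [Nat.le_zero.1 h0, zero_mul] at this
      exact (mul_eq_zero.1 this).resolve_left hpos.ne'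
    rw [List.eq_nil_of_length_eq_zero hnil] at hp₂
    exact hp₂.1 rfl
  obtain ⟨c, e, hce, hc, he⟩ : ∃ c e : ℕ, c.Coprime e ∧
      cnt v₀ y₁ = c * (cnt v₀ y₁).gcd (cnt v₀ y₂) ∧ cnt v₀ y₂ = e * (cnt v₀ y₁).gcd (cnt v₀ y₂) :=
    Nat.exists_coprime _ _
  have hg : 0 < (cnt v₀ y₁).gcd (cnt v₀ y₂) := Nat.gcd_pos_of_pos_left _ hpos
  generalize (cnt v₀ y₁).gcd (cnt v₀ y₂) = k at hc he hg
  have hprop' : ∀ v, e * cnt v y₁ = c * cnt v y₂ := fun v => by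
    refine Nat.eq_of_mul_eq_mul_left hg ?_
    have := hprop v
    rw [hc, he] at this
    linear_combination -this
  have hc0 : 0 < c := Nat.pos_of_ne_zero (by rintro rfl; omega)
  have he0 : 0 < e := Nat.pos_of_ne_zero (by rintro rfl; omega)
  -- In each projection the two powers commute and have the same length, hence are equal.
  have hpow : TraceEq Γ (wpow y₁ e) (wpow y₂ c) := fun v u hd => by
    have h1 := wpow_append_comm (hcomm v u hd) e c
    rw [← proj_wpow, ← proj_wpow] at h1
    refine (List.append_inj h1 ?_).1
    simp only [length_proj, cnt_wpow, hprop']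
  have hxy := hpow.ofWord_eq
  rw [ofWord_wpow, ofWord_wpow] at hxy
  refine hp₁.eq_of_pow_eq hp₂ ?_ he0 hc0 hce.symm hxy
  have := h.ofWord_eq
  rwa [ofWord_append, ofWord_append] at this

end

/-- The part of `h` outside of `a` and `b` is longer than `2 |V| + 1` periods. -/
theorem period_bound {lam N : ℝ} {K n L g a b : ℕ} (hlam : lam < 1 / 2)
    (hN : (2 * (K : ℝ) + 1) / (1 - 2 * lam) ≤ N) (hn : N ≤ n) (hL : n * g ≤ L)
    (ha : (a : ℝ) ≤ lam * L) (hb : (b : ℝ) ≤ lam * L) : a + b + (2 * K + 1) * g ≤ L := by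
  have h0 : 0 < 1 - 2 * lam := by linarith
  have h1 : (2 * (K : ℝ) + 1) ≤ n * (1 - 2 * lam) := (div_le_iff₀ h0).1 (hN.trans hn)
  have h2 : (n : ℝ) * g ≤ L := by exact_mod_cast hL
  have h3 : (2 * (K : ℝ) + 1) * g ≤ (1 - 2 * lam) * L := by
    calc (2 * (K : ℝ) + 1) * g ≤ n * (1 - 2 * lam) * g := by gcongr
      _ = (1 - 2 * lam) * (n * g) := by ring
      _ ≤ (1 - 2 * lam) * L := by gcongr
  have : (a : ℝ) + b + (2 * K + 1) * g ≤ L := by linarith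
  exact_mod_cast this

end QuasiRoot

/-! ### The theorem -/

open QuasiRoot in
theorem mainTheorem1 {V : Type*} [Fintype V] (Γ : SimpleGraph V) (hΓ : Γ.Connected)
    (lam N : ℝ) (hlam0 : 0 ≤ lam) (hlam : lam < 1 / 2)
    (hN : (2 * (Fintype.card V : ℝ) + 1) / (1 - 2 * lam) ≤ N)
    (h a₁ g₁ b₁ a₂ g₂ b₂ : QuasiRoot.OppRAAG Γ) (n₁ n₂ : ℕ)
    (hd₁ : QuasiRoot.IsQuasiRootDecomposition lam N h a₁ g₁ n₁ b₁)
    (hd₂ : QuasiRoot.IsQuasiRootDecomposition lam N h a₂ g₂ n₂ b₂)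
    (hs₁ : QuasiRoot.IsStronglyNonSplit g₁) (hs₂ : QuasiRoot.IsStronglyNonSplit g₂)
    (hp₁ : QuasiRoot.IsPrimitiveElement g₁) (hp₂ : QuasiRoot.IsPrimitiveElement g₂) :
    IsConj g₁ g₂ ∧
      a₁ * g₁ * a₁⁻¹ = a₂ * g₂ * a₂⁻¹ ∧
      b₁⁻¹ * g₁ * b₁ = b₂⁻¹ * g₂ * b₂ := by
  classical
  -- Since `h = a gⁿ b`, conjugating `a g a⁻¹` by `h` gives `b⁻¹ g b`, so the first equality implies
  -- the rest.
  suffices hP : a₁ * g₁ * a₁⁻¹ = a₂ * g₂ * a₂⁻¹ by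
    obtain ⟨-, -, -, -, -, -, -, -, -, hh₁, -⟩ := hd₁.exists_words
    obtain ⟨-, -, -, -, -, -, -, -, -, hh₂, -⟩ := hd₂.exists_words
    refine ⟨?_, hP, ?_⟩
    · rw [isConj_iff]
      refine ⟨a₂⁻¹ * a₁, ?_⟩
      calc a₂⁻¹ * a₁ * g₁ * (a₂⁻¹ * a₁)⁻¹ = a₂⁻¹ * (a₁ * g₁ * a₁⁻¹) * a₂ := by group
        _ = g₂ := by rw [hP]; group
    · have key : ∀ {a g b : OppRAAG Γ} {n : ℕ}, h = a * g ^ n * b →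
          b⁻¹ * g * b = h⁻¹ * (a * g * a⁻¹) * h := by
        rintro a g b n rfl
        group
      rw [key hh₁, key hh₂, hP]
  obtain ⟨A₁, G₁, B₁, hG₁, hA₁, hg₁, hlA₁, hlG₁, hlB₁, -, hr₁, hw₁, hL₁⟩ := hd₁.exists_words
  obtain ⟨A₂, G₂, B₂, hG₂, hA₂, hg₂, hlA₂, hlG₂, hlB₂, -, hr₂, hw₂, hL₂⟩ := hd₂.exists_words
  obtain ⟨-, hN₁, ha₁, hb₁⟩ := hd₁
  obtain ⟨-, hN₂, ha₂, hb₂⟩ := hd₂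
  have heq := hr₂.irred.traceEq hr₁.irred (hw₂.trans hw₁.symm)
  have hpow : ∀ (A G B : List (V × Bool)) {n j : ℕ}, j ≤ n →
      Pre Γ (A ++ wpow G j) (A ++ wpow G n ++ B) := by
    intro A G B n j hj v u _
    obtain ⟨k, rfl⟩ := Nat.exists_eq_add_of_le hj
    simp [wpow_add]
  have hpre₁ : ∀ j ≤ n₁, Pre Γ (A₁ ++ wpow G₁ j) (A₁ ++ wpow G₁ n₁ ++ B₁) :=
    fun j hj => hpow _ _ _ hj
  have hpre₂ : ∀ j ≤ n₂, Pre Γ (A₂ ++ wpow G₂ j) (A₁ ++ wpow G₁ n₁ ++ B₁) :=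
    fun j hj => (hpow _ _ _ hj).trans heq.pre
  generalize A₁ ++ wpow G₁ n₁ ++ B₁ = W at hpre₁ hpre₂ hr₁
  have hS₁ : ∀ v, v ∈ supp g₁ ↔ 0 < cnt v G₁ := hg₁ ▸ mem_supp_iff hG₁
  have hS₂ : ∀ v, v ∈ supp g₂ ↔ 0 < cnt v G₂ := hg₂ ▸ mem_supp_iff hG₂
  have hpos : ∀ {g : OppRAAG Γ} {G : List (V × Bool)}, IsNonSplit g →
      (∀ v, v ∈ supp g ↔ 0 < cnt v G) → 0 < G.length := by
    intro g G hg hS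
    obtain ⟨v, hv⟩ := hg.nonempty
    obtain ⟨b, hb⟩ := cnt_pos_iff.1 ((hS v).1 hv)
    exact List.length_pos_of_mem hb
  -- Stated for arbitrary short ends, because `overlap` also pairs an end of one decomposition with
  -- an end of the other.
  have hbound : ∀ a b : ℕ, (a : ℝ) ≤ lam * wordLength h → (b : ℝ) ≤ lam * wordLength h →
      a + b + (2 * Fintype.card V + 1) * max (wordLength g₁) (wordLength g₂) ≤ wordLength h := by
    intro a b ha hb
    rcases max_choice (wordLength g₁) (wordLength g₂) with hm | hm <;> rw [hm]
    · exact period_bound hlam hN hN₁ (by omega) ha hb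
    · exact period_bound hlam hN hN₂ (by omega) ha hb
  have h₁ := overlap (β := fun v => cnt v A₁) (δ := fun v => cnt v G₁)
    (α := fun v => cnt v A₂) (γ := fun v => cnt v G₂) (n₁ := n₂) (n₂ := n₁)
    (b₁ := wordLength b₂) (b₂ := wordLength b₁) (L := wordLength h)
    (M := max (wordLength g₁) (wordLength g₂)) hS₂ hs₂.1 hs₂.exists_dep
    (fun m hm j hj v u hd hlt => by
      have := (hpre₂ j hj).cnt_le_of_cnt_lt (hpre₁ m hm) hd
      simp only [cnt_append, cnt_wpow] at this
      exact this hlt)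
    (by simp only [sum_cnt, hlA₂, hlG₂, hL₂])
    (by simp only [sum_cnt, hlA₁, hlG₁, hL₁])
    (by simp only [sum_cnt, hlG₂, le_max_right])
    (by simp only [sum_cnt, hlG₁, le_max_left])
    (by simpa only [sum_cnt] using hpos hs₁.1 hS₁)
    (by simpa only [sum_cnt, hlA₂] using hbound _ _ ha₂ hb₂)
    (by simpa only [sum_cnt, hlA₂] using hbound _ _ ha₂ hb₁)
    (by simpa only [sum_cnt, hlA₁] using hbound _ _ ha₁ hb₂)
    (by simpa only [sum_cnt, hlA₁] using hbound _ _ ha₁ hb₁)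
  have h₂ := overlap (α := fun v => cnt v A₁) (γ := fun v => cnt v G₁)
    (β := fun v => cnt v A₂) (δ := fun v => cnt v G₂) (n₁ := n₁) (n₂ := n₂)
    (b₁ := wordLength b₁) (b₂ := wordLength b₂) (L := wordLength h)
    (M := max (wordLength g₁) (wordLength g₂)) hS₁ hs₁.1 hs₁.exists_dep
    (fun m hm j hj v u hd hlt => by
      have := (hpre₁ j hj).cnt_le_of_cnt_lt (hpre₂ m hm) hd
      simp only [cnt_append, cnt_wpow] at this
      exact this hlt)
    (by simp only [sum_cnt, hlA₁, hlG₁, hL₁])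
    (by simp only [sum_cnt, hlA₂, hlG₂, hL₂])
    (by simp only [sum_cnt, hlG₁, le_max_left])
    (by simp only [sum_cnt, hlG₂, le_max_right])
    (by simpa only [sum_cnt] using hpos hs₂.1 hS₂)
    (by simpa only [sum_cnt, hlA₁] using hbound _ _ ha₁ hb₁)
    (by simpa only [sum_cnt, hlA₁] using hbound _ _ ha₁ hb₂)
    (by simpa only [sum_cnt, hlA₂] using hbound _ _ ha₂ hb₁)
    (by simpa only [sum_cnt, hlA₂] using hbound _ _ ha₂ hb₂)
  -- For exponent `0` the truncated `0 - 1` is `0`, and the second half of the estimate would make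
  -- the other period empty.
  have hn : 0 < n₁ ∧ 0 < n₂ := by
    obtain ⟨v, hv⟩ := hs₁.1.nonempty
    obtain ⟨u, hu⟩ := hs₂.1.nonempty
    have hv' := (hS₁ v).1 hv
    have hu' := (hS₂ u).1 hu
    refine ⟨Nat.pos_of_ne_zero ?_, Nat.pos_of_ne_zero ?_⟩
    · rintro rfl
      have := (h₂ u).2
      omega
    · rintro rfl
      have := (h₁ v).2
      omega
  obtain ⟨d, y₁, y₂, hcomm, hc₁, -, he₁, he₂⟩ := exists_commuting_periods hr₁ (hpre₁ _ le_rfl)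
    (hpre₂ _ le_rfl) hn.1 hn.2 h₁ h₂
  rw [hA₁, hg₁] at he₁
  rw [hA₂, hg₂] at he₂
  have hconj : ∀ {a g : OppRAAG Γ}, IsPrimitiveElement g → IsPrimitiveElement (a * g * a⁻¹) :=
    fun {a g} hg => hg.of_conj a⁻¹ (by group)
  have hy := ofWord_eq_of_append_comm hcomm (fun v => by rw [hS₁, hc₁]) hs₁.1 hs₁.exists_dep
    ((hconj hp₁).of_conj d he₁) ((hconj hp₂).of_conj d he₂)
  exact mul_right_cancel (he₁.trans (hy ▸ he₂.symm))
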